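/- **Setting.** Let $\Omega\subset\mathbb R^d$ ($d=2,3$) be a bounded, connected, nonempty open set, $X=H^1_0(\Omega)^d$ (the closure of $C_c^\infty(\Omega)^d$ in the $H^1$ norm), $X'$ its dual, and let $X_h\subset X$ and $Q_h\subset L^2_0(\Omega)$ (zero-mean functions) be finite-dimensional subspaces. Write $\|\cdot\|$ and $(\cdot,\cdot)$ for the $L^2(\Omega)$ norm and inner product, $\|f\|_{-1}=\sup_{0\neq v\in X}\langle f,v\rangle/\|\nabla v\|$ for $f\in X'$, $V_h=\{v\in X_h:(\nabla\cdot v,q)=0\ \forall q\in Q_h\}$, and $$b^*(u,v,w)=\tfrac12(u\cdot\nabla v,w)-\tfrac12(u\cdot\nabla w,v)\qquad(u,v,w\in X).$$ There is a constant $M\ge0$, depending only on $\Omega$, such that $|b^*(u,v,w)|\le M\|\nabla u\|\|\nabla v\|\|\nabla w\|$ for all $u,v,w\in X$; fix any such $M$. Let $\nu>0$, $f\in X'$, and assume the small data condition $\kappa:=M\nu^{-2}\|f\|_{-1}<1$. The Picard solution operator $G:V_h\to V_h$ for the steady Navier–Stokes equations assigns to $z\in V_h$ the unique $G(z)\in V_h$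 with $$b^*(z,G(z),v)+\nu(\nabla G(z),\nabla v)=\langle f,v\rangle\qquad\forall v\in V_h$$ (existence and uniqueness are part of the claim). **Iteration.** The Anderson-accelerated Picard iteration with depth $m=1$ starts from $u_0\in V_h$, sets $\tilde u_{j+1}=G(u_j)$ for $j\ge0$ and $u_1=\tilde u_1$, and for $k\ge2$ sets $$u_k=\alpha_{k-1}^k\tilde u_k+\alpha_{k-2}^k\tilde u_{k-1},$$ where $(\alpha_{k-1}^k,\alpha_{k-2}^k)$ minimizes $\|\nabla(\alpha_{k-1}w_{k-1}+\alpha_{k-2}w_{k-2})\|$ subject to $\alpha_{k-1}+\alpha_{k-2}=1$, and $w_j=G(u_j)-u_j$ is the residual. **Theorem 4.1.** Let $\bar\alpha$ be a real number and let $k\ge2$ be a step with $|\alpha_{k-1}^k|<\bar\alpha$ and $\alpha_{k-2}^k\neq0$. Then there is an optimization gain $\theta_k$ with $0\le\theta_k<1$, $$\min_{\alpha_{k-1}+\alpha_{k-2}=1}\|\nabla(\alpha_{k-1}w_{k-1}+\alpha_{k-2}w_{k-2})\|=\theta_k\|\nabla w_{k-1}\|,$$ such that $$\|\nabla w_k\|\le\kappa\,\|\nabla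 w_{k-1}\|\,\bigl(\theta_k+C_0\|\nabla w_{k-2}\|\bigr),\qquad C_0=\frac{\nu^{-1}M\bar\alpha}{(1-\kappa)^2}.$$ In particular the step locally improves on the Picard contraction factor $\kappa$: if $\kappa\|\nabla w_{k-1}\|>0$ and $C_0\|\nabla w_{k-2}\|<1-\theta_k$, then $\|\nabla w_k\|<\kappa\|\nabla w_{k-1}\|$. -/

import Mathlib

open MeasureTheory
open scoped ContDiff

noncomputable section

namespace SteadyNSE

/-- The Euclidean space `ℝ^d` (points and velocity values). -/
abbrev Vec (d : ℕ) : Type := EuclideanSpace ℝ (Fin d)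

/-- `d × d` matrices with the Frobenius norm and inner product (values of velocity gradients). -/
abbrev Mat (d : ℕ) : Type := EuclideanSpace ℝ (Fin d × Fin d)

/-- Vector fields in `L²(Ω)`. -/
abbrev L2Vec {d : ℕ} (Ω : Set (Vec d)) : Type := Lp (Vec d) 2 (volume.restrict Ω)

/-- Matrix fields in `L²(Ω)`. -/
abbrev L2Mat {d : ℕ} (Ω : Set (Vec d)) : Type := Lp (Mat d) 2 (volume.restrict Ω)

/-- Scalar functions in `L²(Ω)`. -/
abbrev L2Scal {d : ℕ} (Ω : Set (Vec d)) : Type := Lp ℝ 2 (volume.restrict Ω)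

/-- The classical gradient of a vector field: the entry `(i, j)` is `∂ᵢ φⱼ`. -/
def classicalGrad {d : ℕ} (φ : Vec d → Vec d) (x : Vec d) : Mat d :=
  WithLp.toLp 2 fun ij => fderiv ℝ φ x (EuclideanSpace.single ij.1 1) ij.2

/-- The space of all pairs `(φ, ∇φ)`, where `φ` is a smooth vector field with compact support
in `Ω`, as a subspace of `L²(Ω) × L²(Ω)`. -/
def testPairs {d : ℕ} (Ω : Set (Vec d)) : Submodule ℝ (L2Vec Ω × L2Mat Ω) where
  carrier := {p | ∃ φ : Vec d → Vec d, ContDiff ℝ ∞ φ ∧ HasCompactSupport φ ∧ tsupport φ ⊆ Ω ∧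
    p.1 =ᵐ[volume.restrict Ω] φ ∧ p.2 =ᵐ[volume.restrict Ω] classicalGrad φ}
  zero_mem' := by
    refine ⟨0, contDiff_const, HasCompactSupport.zero, ?_, ?_, ?_⟩
    · have h : tsupport (0 : Vec d → Vec d) = ∅ := by simp [tsupport]
      rw [h]; exact Set.empty_subset _
    · exact Lp.coeFn_zero _ _ _
    · refine (Lp.coeFn_zero _ _ _).trans (Filter.Eventually.of_forall fun x => ?_)
      ext ij
      simp [classicalGrad]
  add_mem' := by
    rintro p q ⟨φ, hφ, hφc, hφs, h1, h2⟩ ⟨ψ, hψ, hψc, hψs, k1, k2⟩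
    refine ⟨φ + ψ, hφ.add hψ, hφc.add hψc, ?_, ?_, ?_⟩
    · exact (tsupport_add φ ψ).trans (Set.union_subset hφs hψs)
    · exact (Lp.coeFn_add _ _).trans (h1.add k1)
    · refine (Lp.coeFn_add _ _).trans ((h2.add k2).trans
        (Filter.Eventually.of_forall fun x => ?_))
      have e : fderiv ℝ (φ + ψ) x = fderiv ℝ φ x + fderiv ℝ ψ x :=
        fderiv_add (hφ.differentiable (by simp) x) (hψ.differentiable (by simp) x)
      ext ij
      simp [classicalGrad, e]
  smul_mem' := by
    rintro c p ⟨φ, hφ, hφc, hφs, h1, h2⟩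
    refine ⟨c • φ, hφ.const_smul c, hφc.smul_left (f := fun _ => c), ?_, ?_, ?_⟩
    · exact (closure_mono (Function.support_const_smul_subset c φ)).trans hφs
    · exact (Lp.coeFn_smul _ _).trans (h1.const_smul c)
    · refine (Lp.coeFn_smul _ _).trans ((h2.const_smul c).trans
        (Filter.Eventually.of_forall fun x => ?_))
      have e : fderiv ℝ (c • φ) x = c • fderiv ℝ φ x :=
        fderiv_const_smul (hφ.differentiable (by simp) x) c
      ext ij
      simp [classicalGrad, e]

/-- The velocity space `X = H¹₀(Ω)^d`: the closure of the smooth, compactly supported vector fields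
in the `H¹` topology.  An element is represented by the pair of the field and its weak gradient,
both in `L²(Ω)`. -/
def H10 {d : ℕ} (Ω : Set (Vec d)) : Type := ↥(testPairs Ω).topologicalClosure

variable {d : ℕ} {Ω : Set (Vec d)}

instance H10.instAddCommGroup : AddCommGroup (H10 Ω) := inferInstanceAs (AddCommGroup ↥(testPairs Ω).topologicalClosure)

instance H10.instModule : Module ℝ (H10 Ω) := inferInstanceAs (Module ℝ ↥(testPairs Ω).topologicalClosure)

/-- The field itself, as an `L²` function. -/
def H10.val : H10 Ω →ₗ[ℝ] L2Vec Ω :=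
  (LinearMap.fst ℝ (L2Vec Ω) (L2Mat Ω)).comp (testPairs Ω).topologicalClosure.subtype

/-- The weak gradient `∇u`, as an `L²` function. -/
def H10.grad : H10 Ω →ₗ[ℝ] L2Mat Ω :=
  (LinearMap.snd ℝ (L2Vec Ω) (L2Mat Ω)).comp (testPairs Ω).topologicalClosure.subtype

/-- `X` is normed by `‖∇u‖`, the `L²` norm of the gradient.  Accordingly the operator norm on the
dual `X'` is the negative norm `‖f‖₋₁ = sup ⟨f, v⟩ / ‖∇v‖`. -/
instance H10.instSeminormedAddCommGroup : SeminormedAddCommGroup (H10 Ω) :=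
  SeminormedAddCommGroup.induced (H10 Ω) (L2Mat Ω) (H10.grad (Ω := Ω))

instance H10.instNormedSpace : NormedSpace ℝ (H10 Ω) := NormedSpace.induced ℝ (H10 Ω) (L2Mat Ω) (H10.grad (Ω := Ω))

/-- The norm of `X` is the `L²` norm of the gradient. -/
theorem H10.norm_def (u : H10 Ω) : ‖u‖ = ‖H10.grad u‖ := rfl

/-- The trace of a matrix. -/
def traceCLM (d : ℕ) : Mat d →L[ℝ] ℝ :=
  ∑ i : Fin d, EuclideanSpace.proj ((i, i) : Fin d × Fin d)

/-- The divergence `∇ · u = ∑ᵢ ∂ᵢ uᵢ`, as an `L²` function. -/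
def H10.div : H10 Ω →ₗ[ℝ] L2Scal Ω :=
  ((traceCLM d).compLpL 2 (volume.restrict Ω)).toLinearMap.comp H10.grad

/-- `(u · ∇v, w) = ∫_Ω ∑ⱼ (∑ᵢ uᵢ ∂ᵢ vⱼ) wⱼ`. -/
def convection (u v w : H10 Ω) : ℝ :=
  ∫ x in Ω, ∑ j : Fin d, (∑ i : Fin d, H10.val u x i * H10.grad v x (i, j)) * H10.val w x j

/-- The skew-symmetrized trilinear form `b*(u, v, w) = ½ (u · ∇v, w) - ½ (u · ∇w, v)`. -/
def bStar (u v w : H10 Ω) : ℝ :=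
  1 / 2 * convection u v w - 1 / 2 * convection u w v

/-- `M` is a constant with `|b*(u, v, w)| ≤ M ‖∇u‖ ‖∇v‖ ‖∇w‖` for all `u, v, w ∈ X`. -/
def IsConvectionBound (Ω : Set (Vec d)) (M : ℝ) : Prop :=
  0 ≤ M ∧ ∀ u v w : H10 Ω, |bStar u v w| ≤ M * ‖u‖ * ‖v‖ * ‖w‖

/-- The discretely divergence-free velocities
`V_h = {v ∈ X_h : (∇ · v, q) = 0 for all q ∈ Q_h}`. -/
def discDivFree (Xh : Submodule ℝ (H10 Ω)) (Qh : Submodule ℝ (L2Scal Ω)) :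
    Submodule ℝ (H10 Ω) where
  carrier := {v | v ∈ Xh ∧ ∀ q ∈ Qh, inner ℝ (H10.div v) q = 0}
  zero_mem' := ⟨Xh.zero_mem, fun q _ => by simp⟩
  add_mem' := fun {a b} ha hb => ⟨Xh.add_mem ha.1 hb.1, fun q hq => by
    rw [map_add, inner_add_left, ha.2 q hq, hb.2 q hq, add_zero]⟩
  smul_mem' := fun c a ha => ⟨Xh.smul_mem c ha.1, fun q hq => by
    rw [map_smul, real_inner_smul_left, ha.2 q hq, mul_zero]⟩

/-- `z ∈ V` solves the Picard linearization at `w`: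
`b*(w, z, v) + ν (∇z, ∇v) = ⟨f, v⟩` for all `v ∈ V`. -/
def IsPicardSolution (ν : ℝ) (f : StrongDual ℝ (H10 Ω)) (V : Submodule ℝ (H10 Ω))
    (w z : V) : Prop :=
  ∀ v : V, bStar (w : H10 Ω) z v + ν * inner ℝ (H10.grad (z : H10 Ω)) (H10.grad (v : H10 Ω)) = f v

/-- The Picard solution operator `G : V → V`: `G w` is the solution of the linear problem
`IsPicardSolution ν f V w` (which has exactly one solution when `0 < ν`, by coercivity). -/
def picardOp (ν : ℝ) (f : StrongDual ℝ (H10 Ω)) (V : Submodule ℝ (H10 Ω)) (w : V) : V :=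
  Classical.epsilon fun z : V => IsPicardSolution ν f V w z

/-- The data-dependent constant `κ = M ν⁻² ‖f‖₋₁`. -/
def kappa (M ν : ℝ) (f : StrongDual ℝ (H10 Ω)) : ℝ := M * ν⁻¹ ^ 2 * ‖f‖

section Anderson

variable {X : Type*} [SeminormedAddCommGroup X] [NormedSpace ℝ X]

/-- The history window `{k - m_k, …, k}` with `m_k = min k m`. -/
def window (m k : ℕ) : Finset ℕ := Finset.Icc (k - min k m) k

/-- The residual `w_k = G(u_k) - u_k`. -/
def residual (G : X → X) (u : ℕ → X) (k : ℕ) : X := G (u k) - u k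

/-- `u`, `ut` and `α` (with `α k j = α_j^k`) are the iterates, the fixed-point updates `ũ` and the
coefficients of an Anderson iteration with depth `m` for `G`.
(For `k = 0` the window is `{0}`, so that `u 1 = ut 1 = G (u 0)`.) -/
structure IsAndersonIteration (G : X → X) (m : ℕ) (u ut : ℕ → X) (α : ℕ → ℕ → ℝ) : Prop where
  fixedPointUpdate : ∀ k, ut (k + 1) = G (u k)
  sum_eq_one : ∀ k, ∑ j ∈ window m k, α (k + 1) j = 1
  minimal : ∀ k, ∀ β : ℕ → ℝ, ∑ j ∈ window m k, β j = 1 →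
    ‖∑ j ∈ window m k, α (k + 1) j • (ut (j + 1) - u j)‖ ≤
      ‖∑ j ∈ window m k, β j • (ut (j + 1) - u j)‖
  update : ∀ k, u (k + 1) = ∑ j ∈ window m k, α (k + 1) j • ut (j + 1)

/-- `θ` is the gain of the optimization that determines `u_{k+1}`:
the minimum of `‖∑_j β_j (ũ_{j+1} - u_j)‖` over all `β` with `∑_j β_j = 1` is
`θ ‖ũ_{k+1} - u_k‖`. -/
def IsOptimizationGain (m : ℕ) (u ut : ℕ → X) (k : ℕ) (θ : ℝ) : Prop :=
  IsLeast {r : ℝ | ∃ β : ℕ → ℝ, ∑ j ∈ window m k, β j = 1 ∧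
    r = ‖∑ j ∈ window m k, β j • (ut (j + 1) - u j)‖} (θ * ‖ut (k + 1) - u k‖)

end Anderson

end SteadyNSE

end

/-! Write `x`, `y` for the last two iterates and `u = (1 - b) G x + b G y` for the next one. Mixing
the equations for `G x` and `G y` does not give the linearized equation for `u` at the mixed point
`(1 - b) x + b y`: bilinearity leaves the defect `(1 - b) b B (x - y) (G x - G y)`. Comparing with
the equation for `G u` and testing with `G u - u`, where skew-symmetry removes one convection term,
bounds the new residual by `κ` times the mixed residual plus a term quadratic in differences of
iterates (`norm_residual_mix_le`).

The mixed residual is `θ` times the last one. For the quadratic term, optimality makes the mixed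
residual orthogonal to the difference of residuals, so `|b|` times that difference is at most the
last residual. Since `G` is a `κ`-contraction, a difference of iterates is at most `(1 - κ)⁻¹` times
the difference of residuals. This and `norm_increment_le` each cost one factor `(1 - κ)⁻¹`, whence
the square in `C₀`.

Strictness `θ < 1` is Pythagoras, provided the two residuals differ; if they agreed, the iterates
would agree, and a stagnating iteration has zero residual.

All of this is abstract Hilbert space geometry. The analytic input is the embedding of `H¹₀` in
`L⁴`: it makes `b*` a bounded trilinear form and the gradient seminorm definite. -/

noncomputable section

namespace SteadyNSE

/-! ### Embedding of `H¹₀` in `L⁴` in dimensions two and three. -/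

section Sobolev

variable {d : ℕ} {Ω : Set (Vec d)}

/-- The operator norm of the derivative is controlled by the Frobenius norm of the gradient. -/
theorem norm_fderiv_le_classicalGrad (φ : Vec d → Vec d) (x : Vec d) :
    ‖fderiv ℝ φ x‖ ≤ d * d * ‖classicalGrad φ x‖ := by
  refine ContinuousLinearMap.opNorm_le_bound _ (by positivity) fun v => ?_
  have hv : v = ∑ i : Fin d, v i • EuclideanSpace.single i (1 : ℝ) := by
    ext j
    simp [Pi.single_apply]
  have hcol : ∀ i : Fin d,
      ‖fderiv ℝ φ x (EuclideanSpace.single i 1)‖ ≤ d * ‖classicalGrad φ x‖ := fun i => by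
    have hw : fderiv ℝ φ x (EuclideanSpace.single i 1)
        = ∑ j : Fin d, (classicalGrad φ x (i, j)) • EuclideanSpace.single j (1 : ℝ) := by
      ext j
      simp [Pi.single_apply, classicalGrad]
    rw [hw]
    refine (norm_sum_le _ _).trans ?_
    refine (Finset.sum_le_sum (g := fun _ => ‖classicalGrad φ x‖) fun j _ => ?_).trans (by simp)
    rw [norm_smul, PiLp.norm_single, norm_one, mul_one]
    exact PiLp.norm_apply_le _ _
  conv_lhs => rw [hv, map_sum]
  refine (norm_sum_le _ _).trans ?_
  refine (Finset.sum_le_sum (g := fun _ => ‖v‖ * (d * ‖classicalGrad φ x‖)) fun i _ => ?_).trans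
    (le_of_eq ?_)
  · rw [map_smul, norm_smul]
    exact mul_le_mul (PiLp.norm_apply_le _ _) (hcol i) (norm_nonneg _) (norm_nonneg _)
  · simp; ring

theorem eLpNorm_restrict_of_support_subset {α F : Type*} [MeasurableSpace α]
    [NormedAddCommGroup F] {μ : Measure α} {s : Set α} {f : α → F} {p : ENNReal}
    (h : Function.support f ⊆ s) : eLpNorm f p (μ.restrict s) = eLpNorm f p μ :=
  eLpNorm_restrict_eq_of_support_subset h

/-- Gagliardo–Nirenberg–Sobolev for test fields: `‖φ‖_{L⁴} ≤ C ‖∇φ‖_{L²}` in dimensions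
two and three. -/
theorem exists_eLpNorm_four_le_classicalGrad (hd : d = 2 ∨ d = 3) (hΩ : Bornology.IsBounded Ω) :
    ∃ C : NNReal, ∀ φ : Vec d → Vec d, ContDiff ℝ ∞ φ → tsupport φ ⊆ Ω →
      eLpNorm φ 4 (volume.restrict Ω) ≤ C * eLpNorm (classicalGrad φ) 2 (volume.restrict Ω) := by
  have hfin : volume Ω < ⊤ := hΩ.measure_lt_top
  -- The exponent `12/7` serves both dimensions: it is critical for `L⁴` when `d = 3`, and stays
  -- below `2`, as the inequality requires when `d = 2`. Boundedness of `Ω` then allows passing from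
  -- `12/7` to `2`.
  set A := eLpNormLESNormFDerivOfLeConst (Vec d) (volume : Measure (Vec d)) Ω (12 / 7) 4
  set B : ENNReal := volume Ω ^ (1 / (((12 / 7 : NNReal) : ENNReal)).toReal - 1 / (2 : ENNReal).toReal)
    with hB
  have hBtop : B ≠ ⊤ := by
    refine ENNReal.rpow_ne_top_of_nonneg ?_ hfin.ne
    rw [ENNReal.coe_toReal]
    norm_num
  refine ⟨A * ((d * d : ℕ) * B.toNNReal), fun φ hφ hs => ?_⟩
  have h1 : eLpNorm φ ((4 : NNReal) : ENNReal) volume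
      ≤ A * eLpNorm (fderiv ℝ φ) ((12 / 7 : NNReal) : ENNReal) volume := by
    refine eLpNorm_le_eLpNorm_fderiv_of_le volume (hφ.of_le (by simp)) (subset_closure.trans hs)
      ?_ ?_ ?_ hΩ
    · rw [← NNReal.coe_le_coe]; norm_num
    · rw [← NNReal.coe_lt_coe]
      rcases hd with rfl | rfl <;> simp <;> norm_num
    · rcases hd with rfl | rfl <;> simp <;> norm_num
  have h2 : eLpNorm (fderiv ℝ φ) ((12 / 7 : NNReal) : ENNReal) volume
      = eLpNorm (fderiv ℝ φ) ((12 / 7 : NNReal) : ENNReal) (volume.restrict Ω) :=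
    (eLpNorm_restrict_of_support_subset ((support_fderiv_subset ℝ).trans hs)).symm
  have h3 : eLpNorm (fderiv ℝ φ) ((12 / 7 : NNReal) : ENNReal) (volume.restrict Ω)
      ≤ eLpNorm (fderiv ℝ φ) 2 (volume.restrict Ω) * B := by
    have := eLpNorm_le_eLpNorm_mul_rpow_measure_univ (μ := volume.restrict Ω) (f := fderiv ℝ φ)
      (p := ((12 / 7 : NNReal) : ENNReal)) (q := 2) ?_
      (hφ.continuous_fderiv (by simp)).aestronglyMeasurable
    · rwa [Measure.restrict_apply_univ] at this
    · rw [show (2 : ENNReal) = ((2 : NNReal) : ENNReal) by simp, ENNReal.coe_le_coe,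
        ← NNReal.coe_le_coe]
      norm_num
  have h4 : eLpNorm (fderiv ℝ φ) 2 (volume.restrict Ω)
      ≤ (d * d : ℕ) * eLpNorm (classicalGrad φ) 2 (volume.restrict Ω) := by
    have := eLpNorm_le_mul_eLpNorm_of_ae_le_mul (μ := volume.restrict Ω) (c := ((d * d : ℕ) : ℝ))
      (f := fderiv ℝ φ) (g := classicalGrad φ)
      (Filter.Eventually.of_forall fun x => by
        simpa using norm_fderiv_le_classicalGrad φ x) 2
    rwa [ENNReal.ofReal_natCast] at this
  calc eLpNorm φ 4 (volume.restrict Ω) ≤ eLpNorm φ 4 volume := eLpNorm_restrict_le _ _ _ _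
    _ ≤ A * ((((d * d : ℕ) * eLpNorm (classicalGrad φ) 2 (volume.restrict Ω))) * B) :=
        h1.trans (by rw [h2]; gcongr; exact h3.trans (by gcongr))
    _ = _ := by
        rw [ENNReal.coe_mul, ENNReal.coe_mul, ENNReal.coe_toNNReal hBtop, ENNReal.coe_natCast]
        ring

/-- The Sobolev inequality `‖u‖_{L⁴} ≤ C ‖∇u‖` on `H¹₀(Ω)^d`, for `d = 2, 3`. -/
theorem exists_eLpNorm_four_le (hd : d = 2 ∨ d = 3) (hΩ : Bornology.IsBounded Ω) :
    ∃ C : NNReal, ∀ u : H10 Ω,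
      eLpNorm (H10.val u) 4 (volume.restrict Ω)
        ≤ C * eLpNorm (H10.grad u) 2 (volume.restrict Ω) := by
  obtain ⟨C, hC⟩ := exists_eLpNorm_four_le_classicalGrad hd hΩ
  refine ⟨C, fun u => ?_⟩
  obtain ⟨p, hp, hlim⟩ := mem_closure_iff_seq_limit.1
    (show (u.1 : L2Vec Ω × L2Mat Ω) ∈ closure (testPairs Ω : Set (L2Vec Ω × L2Mat Ω)) from u.2)
  have h1 : Filter.Tendsto (fun n => (p n).1) Filter.atTop (nhds (H10.val u)) :=
    (continuous_fst.tendsto _).comp hlim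
  have h2 : Filter.Tendsto (fun n => (p n).2) Filter.atTop (nhds (H10.grad u)) :=
    (continuous_snd.tendsto _).comp hlim
  have hbound : ∀ n, eLpNorm (p n).1 4 (volume.restrict Ω)
      ≤ C * eLpNorm (p n).2 2 (volume.restrict Ω) := fun n => by
    obtain ⟨φ, hφ, -, hs, e1, e2⟩ := hp n
    rw [eLpNorm_congr_ae e1, eLpNorm_congr_ae e2]
    exact hC φ hφ hs
  obtain ⟨ns, hns, hae⟩ := (tendstoInMeasure_of_tendsto_Lp h1).exists_seq_tendsto_ae
  -- The approximating fields converge only in `L²`; Fatou along an a.e. convergent subsequence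
  -- transfers the `L⁴` bound.
  refine (Lp.eLpNorm_lim_le_liminf_eLpNorm
    (fun n => (Lp.aestronglyMeasurable (p (ns n)).1)) _ hae).trans ?_
  refine (Filter.liminf_le_liminf (Filter.Eventually.of_forall fun n => hbound (ns n))).trans ?_
  refine le_of_eq (Filter.Tendsto.liminf_eq ?_)
  refine ENNReal.Tendsto.const_mul ?_ (Or.inr ENNReal.coe_ne_top)
  have h3 := ((continuous_enorm.tendsto _).comp h2).comp hns.tendsto_atTop
  simpa only [Lp.enorm_def, Function.comp_def] using h3

/-- The gradient is injective on `H¹₀(Ω)^d`. -/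
theorem H10.eq_zero_of_grad_eq_zero (hd : d = 2 ∨ d = 3) (hΩ : Bornology.IsBounded Ω)
    {u : H10 Ω} (hu : H10.grad u = 0) : u = 0 := by
  obtain ⟨C, hC⟩ := exists_eLpNorm_four_le hd hΩ
  have h0 : eLpNorm (H10.val u) 4 (volume.restrict Ω) = 0 := by
    have := hC u
    rw [hu, eLpNorm_congr_ae (Lp.coeFn_zero (Mat d) 2 (volume.restrict Ω)), eLpNorm_zero,
      mul_zero] at this
    exact le_antisymm this bot_le
  rw [eLpNorm_eq_zero_iff (Lp.aestronglyMeasurable _) (by norm_num)] at h0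
  exact Subtype.ext (Prod.ext ((Lp.eq_zero_iff_ae_eq_zero).2 h0) hu)

end Sobolev

/-! ### Boundedness and trilinearity of the convection form. -/

section Convection

variable {d : ℕ} {Ω : Set (Vec d)}

/-- The pointwise convection term `∑ⱼ (∑ᵢ aᵢ Dᵢⱼ) bⱼ`. -/
def convectionPt (a : Vec d) (D : Mat d) (b : Vec d) : ℝ :=
  ∑ j : Fin d, (∑ i : Fin d, a i * D (i, j)) * b j

theorem convectionPt_lincomb_left (c : ℝ) (a a' : Vec d) (D : Mat d) (b : Vec d) :
    convectionPt (c • a + a') D b = c * convectionPt a D b + convectionPt a' D b := by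
  unfold convectionPt
  rw [Finset.mul_sum, ← Finset.sum_add_distrib]
  refine Finset.sum_congr rfl fun j _ => ?_
  rw [← mul_assoc, ← add_mul, Finset.mul_sum, ← Finset.sum_add_distrib]
  congr 1
  refine Finset.sum_congr rfl fun i _ => ?_
  rw [PiLp.add_apply, PiLp.smul_apply, smul_eq_mul]
  ring

theorem convectionPt_lincomb_mid (c : ℝ) (a : Vec d) (D D' : Mat d) (b : Vec d) :
    convectionPt a (c • D + D') b = c * convectionPt a D b + convectionPt a D' b := by
  unfold convectionPt
  rw [Finset.mul_sum, ← Finset.sum_add_distrib]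
  refine Finset.sum_congr rfl fun j _ => ?_
  rw [← mul_assoc, ← add_mul, Finset.mul_sum, ← Finset.sum_add_distrib]
  congr 1
  refine Finset.sum_congr rfl fun i _ => ?_
  rw [PiLp.add_apply, PiLp.smul_apply, smul_eq_mul]
  ring

theorem convectionPt_lincomb_right (c : ℝ) (a : Vec d) (D : Mat d) (b b' : Vec d) :
    convectionPt a D (c • b + b') = c * convectionPt a D b + convectionPt a D b' := by
  unfold convectionPt
  rw [Finset.mul_sum, ← Finset.sum_add_distrib]
  refine Finset.sum_congr rfl fun j _ => ?_
  rw [PiLp.add_apply, PiLp.smul_apply, smul_eq_mul]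
  ring

theorem norm_convectionPt_le (a : Vec d) (D : Mat d) (b : Vec d) :
    ‖convectionPt a D b‖ ≤ d * d * (‖a‖ * ‖D‖ * ‖b‖) := by
  refine (norm_sum_le _ _).trans ?_
  refine (Finset.sum_le_sum (g := fun _ => d * (‖a‖ * ‖D‖) * ‖b‖) fun j _ => ?_).trans
    (le_of_eq ?_)
  · rw [norm_mul]
    refine mul_le_mul ?_ (PiLp.norm_apply_le _ _) (norm_nonneg _) (by positivity)
    refine (norm_sum_le _ _).trans ?_
    refine (Finset.sum_le_sum (g := fun _ => ‖a‖ * ‖D‖) fun i _ => ?_).trans (by simp)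
    rw [norm_mul]
    exact mul_le_mul (PiLp.norm_apply_le _ _) (PiLp.norm_apply_le _ _) (norm_nonneg _)
      (norm_nonneg _)
  · simp; ring

theorem continuous_convectionPt :
    Continuous fun p : Vec d × Mat d × Vec d => convectionPt p.1 p.2.1 p.2.2 := by
  unfold convectionPt
  fun_prop

theorem aestronglyMeasurable_convectionPt {α : Type*} [MeasurableSpace α] {μ : Measure α}
    {f g : α → Vec d} {D : α → Mat d} (hf : AEStronglyMeasurable f μ)
    (hD : AEStronglyMeasurable D μ) (hg : AEStronglyMeasurable g μ) :
    AEStronglyMeasurable (fun x => convectionPt (f x) (D x) (g x)) μ :=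
  Continuous.comp_aestronglyMeasurable (f := fun x => (f x, D x, g x)) continuous_convectionPt
    (hf.prodMk (hD.prodMk hg))

/-- Hölder's inequality with exponents `4, 2, 4` for the convection term. -/
theorem eLpNorm_convectionPt_le {α : Type*} [MeasurableSpace α] {μ : Measure α}
    {f g : α → Vec d} {D : α → Mat d} (hf : AEStronglyMeasurable f μ)
    (hD : AEStronglyMeasurable D μ) (hg : AEStronglyMeasurable g μ) :
    eLpNorm (fun x => convectionPt (f x) (D x) (g x)) 1 μ
      ≤ ((d * d : ℕ) : ENNReal) * ((eLpNorm f 4 μ * eLpNorm g 4 μ) * eLpNorm D 2 μ) := by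
  have : ENNReal.HolderTriple 4 4 2 := ⟨by
    rw [← two_mul, show (4 : ENNReal) = 2 * 2 by norm_num, ENNReal.mul_inv (by simp) (by simp),
      ← mul_assoc, ENNReal.mul_inv_cancel (by simp) (by simp), one_mul]⟩
  have hfg : eLpNorm (fun x => ‖f x‖ * ‖g x‖) 2 μ ≤ eLpNorm f 4 μ * eLpNorm g 4 μ := by
    have := eLpNorm_smul_le_mul_eLpNorm (p := 4) (q := 4) (r := 2) hg.norm hf.norm
    rwa [eLpNorm_norm, eLpNorm_norm] at this
  have hall : eLpNorm (fun x => (‖f x‖ * ‖g x‖) * ‖D x‖) 1 μ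
      ≤ eLpNorm (fun x => ‖f x‖ * ‖g x‖) 2 μ * eLpNorm D 2 μ := by
    have := eLpNorm_smul_le_mul_eLpNorm (p := 2) (q := 2) (r := 1) hD.norm (hf.norm.mul hg.norm)
    rwa [eLpNorm_norm] at this
  have hpt := eLpNorm_le_mul_eLpNorm_of_ae_le_mul (μ := μ) (c := ((d * d : ℕ) : ℝ))
      (f := fun x => convectionPt (f x) (D x) (g x))
      (g := fun x => (‖f x‖ * ‖g x‖) * ‖D x‖)
      (Filter.Eventually.of_forall fun x => by
        refine (norm_convectionPt_le _ _ _).trans (le_of_eq ?_)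
        rw [norm_mul, norm_mul, norm_norm, norm_norm, norm_norm]
        push_cast; ring) 1
  rw [ENNReal.ofReal_natCast] at hpt
  exact hpt.trans (mul_le_mul' le_rfl (hall.trans (mul_le_mul' hfg le_rfl)))

theorem H10.eLpNorm_grad (z : H10 Ω) :
    eLpNorm (H10.grad z) 2 (volume.restrict Ω) = ‖z‖ₑ :=
  (Lp.enorm_def (H10.grad z)).symm

/-- The integrand of the convection term is in `L¹`, with norm controlled by the gradients. -/
theorem exists_eLpNorm_convectionPt_le (hd : d = 2 ∨ d = 3) (hΩ : Bornology.IsBounded Ω) :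
    ∃ K : NNReal, ∀ u v w : H10 Ω,
      eLpNorm (fun x => convectionPt (H10.val u x) (H10.grad v x) (H10.val w x)) 1
        (volume.restrict Ω) ≤ K * ‖u‖ₑ * ‖v‖ₑ * ‖w‖ₑ := by
  obtain ⟨C, hC⟩ := exists_eLpNorm_four_le hd hΩ
  simp only [H10.eLpNorm_grad] at hC
  refine ⟨(d * d : ℕ) * (C * C), fun u v w => ?_⟩
  refine (eLpNorm_convectionPt_le (Lp.aestronglyMeasurable _) (Lp.aestronglyMeasurable _)
    (Lp.aestronglyMeasurable _)).trans ?_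
  rw [H10.eLpNorm_grad]
  refine (mul_le_mul' le_rfl (mul_le_mul' (mul_le_mul' (hC u) (hC w)) le_rfl)).trans
    (le_of_eq ?_)
  rw [ENNReal.coe_mul, ENNReal.coe_mul, ENNReal.coe_natCast]
  ring

/-- Needed for additivity of the integral, hence for trilinearity of `b*`. -/
theorem integrable_convectionPt (hd : d = 2 ∨ d = 3) (hΩ : Bornology.IsBounded Ω)
    (u v w : H10 Ω) :
    Integrable (fun x => convectionPt (H10.val u x) (H10.grad v x) (H10.val w x))
      (volume.restrict Ω) := by
  obtain ⟨K, hK⟩ := exists_eLpNorm_convectionPt_le hd hΩ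
  rw [← memLp_one_iff_integrable]
  refine ⟨aestronglyMeasurable_convectionPt (Lp.aestronglyMeasurable _)
    (Lp.aestronglyMeasurable _) (Lp.aestronglyMeasurable _), (hK u v w).trans_lt ?_⟩
  exact ENNReal.mul_lt_top (ENNReal.mul_lt_top (ENNReal.mul_lt_top ENNReal.coe_lt_top
    enorm_lt_top) enorm_lt_top) enorm_lt_top

theorem exists_abs_convection_le (hd : d = 2 ∨ d = 3) (hΩ : Bornology.IsBounded Ω) :
    ∃ K : ℝ, 0 ≤ K ∧ ∀ u v w : H10 Ω, |convection u v w| ≤ K * ‖u‖ * ‖v‖ * ‖w‖ := by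
  obtain ⟨K, hK⟩ := exists_eLpNorm_convectionPt_le hd hΩ
  refine ⟨K, K.2, fun u v w => ?_⟩
  have h := (enorm_integral_le_lintegral_enorm
    (fun x => convectionPt (H10.val u x) (H10.grad v x) (H10.val w x))).trans
      ((eLpNorm_one_eq_lintegral_enorm).symm.le.trans (hK u v w))
  have h' := ENNReal.toReal_mono (by
    exact (ENNReal.mul_lt_top (ENNReal.mul_lt_top (ENNReal.mul_lt_top ENNReal.coe_lt_top
      enorm_lt_top) enorm_lt_top) enorm_lt_top).ne) h
  have h2 : (K * ‖u‖ₑ * ‖v‖ₑ * ‖w‖ₑ : ENNReal).toReal = K * ‖u‖ * ‖v‖ * ‖w‖ := by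
    simp [ENNReal.toReal_mul]
  rw [h2, toReal_enorm] at h'
  exact h'

theorem exists_isConvectionBound (hd : d = 2 ∨ d = 3) (hΩ : Bornology.IsBounded Ω) :
    ∃ M : ℝ, IsConvectionBound Ω M := by
  obtain ⟨K, hK0, hK⟩ := exists_abs_convection_le hd hΩ
  refine ⟨K, hK0, fun u v w => ?_⟩
  have h1 := abs_le.1 (hK u v w)
  have h2 := abs_le.1 (hK u w v)
  have e : K * ‖u‖ * ‖w‖ * ‖v‖ = K * ‖u‖ * ‖v‖ * ‖w‖ := by ring
  rw [e] at h2
  unfold bStar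
  exact abs_le.2 ⟨by linarith, by linarith⟩

/-- Additivity and homogeneity in one argument transfer from the pointwise term to `convection`. -/
theorem convection_lincomb (hd : d = 2 ∨ d = 3) (hΩ : Bornology.IsBounded Ω)
    {u v w u₁ v₁ w₁ u₂ v₂ w₂ : H10 Ω} (c : ℝ)
    (h : ∀ᵐ x ∂volume.restrict Ω, convectionPt (H10.val u x) (H10.grad v x) (H10.val w x)
      = c * convectionPt (H10.val u₁ x) (H10.grad v₁ x) (H10.val w₁ x)
        + convectionPt (H10.val u₂ x) (H10.grad v₂ x) (H10.val w₂ x)) :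
    convection u v w = c * convection u₁ v₁ w₁ + convection u₂ v₂ w₂ := by
  refine (integral_congr_ae h).trans ?_
  rw [integral_add ((integrable_convectionPt hd hΩ u₁ v₁ w₁).const_mul c)
    (integrable_convectionPt hd hΩ u₂ v₂ w₂), integral_const_mul]
  rfl

theorem val_lincomb_ae (c : ℝ) (a b : H10 Ω) :
    ∀ᵐ x ∂volume.restrict Ω, H10.val (c • a + b) x = c • H10.val a x + H10.val b x := by
  rw [map_add, map_smul]
  filter_upwards [Lp.coeFn_add (c • H10.val a) (H10.val b), Lp.coeFn_smul c (H10.val a)]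
    with x h1 h2
  rw [h1, Pi.add_apply, h2, Pi.smul_apply]

theorem grad_lincomb_ae (c : ℝ) (a b : H10 Ω) :
    ∀ᵐ x ∂volume.restrict Ω, H10.grad (c • a + b) x = c • H10.grad a x + H10.grad b x := by
  rw [map_add, map_smul]
  filter_upwards [Lp.coeFn_add (c • H10.grad a) (H10.grad b), Lp.coeFn_smul c (H10.grad a)]
    with x h1 h2
  rw [h1, Pi.add_apply, h2, Pi.smul_apply]

theorem convection_lincomb_left (hd : d = 2 ∨ d = 3) (hΩ : Bornology.IsBounded Ω)
    (c : ℝ) (a b v w : H10 Ω) :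
    convection (c • a + b) v w = c * convection a v w + convection b v w := by
  refine convection_lincomb hd hΩ c ?_
  filter_upwards [val_lincomb_ae c a b] with x hx
  rw [hx, convectionPt_lincomb_left]

theorem convection_lincomb_mid (hd : d = 2 ∨ d = 3) (hΩ : Bornology.IsBounded Ω)
    (c : ℝ) (a b v w : H10 Ω) :
    convection v (c • a + b) w = c * convection v a w + convection v b w := by
  refine convection_lincomb hd hΩ c ?_
  filter_upwards [grad_lincomb_ae c a b] with x hx
  rw [hx, convectionPt_lincomb_mid]

theorem convection_lincomb_right (hd : d = 2 ∨ d = 3) (hΩ : Bornology.IsBounded Ω)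
    (c : ℝ) (a b v w : H10 Ω) :
    convection v w (c • a + b) = c * convection v w a + convection v w b := by
  refine convection_lincomb hd hΩ c ?_
  filter_upwards [val_lincomb_ae c a b] with x hx
  rw [hx, convectionPt_lincomb_right]

theorem bStar_lincomb_left (hd : d = 2 ∨ d = 3) (hΩ : Bornology.IsBounded Ω)
    (c : ℝ) (a b v w : H10 Ω) :
    bStar (c • a + b) v w = c * bStar a v w + bStar b v w := by
  simp only [bStar, convection_lincomb_left hd hΩ]; ring

theorem bStar_lincomb_mid (hd : d = 2 ∨ d = 3) (hΩ : Bornology.IsBounded Ω)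
    (c : ℝ) (a b v w : H10 Ω) :
    bStar v (c • a + b) w = c * bStar v a w + bStar v b w := by
  simp only [bStar, convection_lincomb_mid hd hΩ, convection_lincomb_right hd hΩ]; ring

theorem bStar_lincomb_right (hd : d = 2 ∨ d = 3) (hΩ : Bornology.IsBounded Ω)
    (c : ℝ) (a b v w : H10 Ω) :
    bStar v w (c • a + b) = c * bStar v w a + bStar v w b := by
  simp only [bStar, convection_lincomb_mid hd hΩ, convection_lincomb_right hd hΩ]; ring

/-- A function compatible with `c • a + b`, as a linear map. -/
def linOfLincomb {V W : Type*} [AddCommGroup V] [Module ℝ V] [AddCommGroup W] [Module ℝ W]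
    (g : V → W) (h : ∀ (c : ℝ) (a b : V), g (c • a + b) = c • g a + g b) : V →ₗ[ℝ] W :=
  have h0 : g 0 = 0 := by simpa using h 1 0 0
  { toFun := g
    map_add' := fun a b => by simpa using h 1 a b
    map_smul' := fun c a => by simpa [h0] using h c a 0 }

/-- A function of three variables that is linear in each of them, as a trilinear map. -/
def trilinOfLincomb {V : Type*} [AddCommGroup V] [Module ℝ V] (g : V → V → V → ℝ)
    (hl : ∀ (c : ℝ) (a b v w : V), g (c • a + b) v w = c * g a v w + g b v w)
    (hm : ∀ (c : ℝ) (a b u w : V), g u (c • a + b) w = c * g u a w + g u b w)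
    (hr : ∀ (c : ℝ) (a b u v : V), g u v (c • a + b) = c * g u v a + g u v b) :
    V →ₗ[ℝ] V →ₗ[ℝ] V →ₗ[ℝ] ℝ :=
  linOfLincomb (fun u => linOfLincomb (fun v => linOfLincomb (g u v)
      (fun c a b => hr c a b u v))
      (fun c a b => LinearMap.ext fun w => hm c a b u w))
    (fun c a b => LinearMap.ext fun v => LinearMap.ext fun w => hl c a b v w)

/-- The form `b*` as a trilinear map on a subspace. -/
def bStarLin (hd : d = 2 ∨ d = 3) (hΩ : Bornology.IsBounded Ω) (V : Submodule ℝ (H10 Ω)) :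
    V →ₗ[ℝ] V →ₗ[ℝ] V →ₗ[ℝ] ℝ :=
  trilinOfLincomb (fun u v w : V => bStar (u : H10 Ω) v w)
    (fun c a b v w => by
      rw [Submodule.coe_add, Submodule.coe_smul, bStar_lincomb_left hd hΩ])
    (fun c a b u w => by
      rw [Submodule.coe_add, Submodule.coe_smul, bStar_lincomb_mid hd hΩ])
    (fun c a b u v => by
      rw [Submodule.coe_add, Submodule.coe_smul, bStar_lincomb_right hd hΩ])

end Convection

end SteadyNSE

namespace SteadyNSE

/-! ### Orthogonality at a minimizer and skew linear problems, in abstract form. -/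

section Abstract

variable {V E : Type*} [SeminormedAddCommGroup V] [NormedSpace ℝ V]
  [NormedAddCommGroup E] [InnerProductSpace ℝ E]

/-- A minimizer of the norm along a line is orthogonal to its direction. -/
theorem inner_eq_zero_of_norm_le {y e : E} (h : ∀ s : ℝ, ‖y‖ ≤ ‖y + s • e‖) :
    inner ℝ y e = 0 := by
  by_contra hne
  have he : 0 < ‖e‖ ^ 2 := by
    have : e ≠ 0 := fun h0 => hne (by rw [h0, inner_zero_right])
    positivity
  -- The competitor is the foot of the perpendicular, which would lower `‖y‖ ^ 2` by `(inner ℝ y e)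
  -- ^ 2 / ‖e‖ ^ 2`.
  have h1 := pow_le_pow_left₀ (norm_nonneg y) (h (-(inner ℝ y e) / ‖e‖ ^ 2)) 2
  rw [norm_add_sq_real, real_inner_smul_right, norm_smul, mul_pow, Real.norm_eq_abs, sq_abs] at h1
  have h2 : 2 * (-(inner ℝ y e) / ‖e‖ ^ 2 * inner ℝ y e)
      + (-(inner ℝ y e) / ‖e‖ ^ 2) ^ 2 * ‖e‖ ^ 2 = -((inner ℝ y e) ^ 2 / ‖e‖ ^ 2) := by
    field_simp; ring
  have h3 : 0 < (inner ℝ y e) ^ 2 / ‖e‖ ^ 2 := by positivity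
  linarith

/-- `x + b • e` being orthogonal to `e` bounds the correction by `x`. -/
theorem abs_mul_norm_le_of_inner_eq_zero {x e : E} {b : ℝ} (h : inner ℝ (x + b • e) e = 0) :
    |b| * ‖e‖ ≤ ‖x‖ := by
  have h1 : ‖x‖ ^ 2 = ‖x + b • e‖ ^ 2 + (|b| * ‖e‖) ^ 2 := by
    have : x = (x + b • e) - b • e := by abel
    conv_lhs => rw [this]
    rw [norm_sub_sq_real, real_inner_smul_right, h, norm_smul, Real.norm_eq_abs]
    ring
  exact abs_le_of_sq_le_sq' (by nlinarith [sq_nonneg ‖x + b • e‖]) (norm_nonneg _) |>.2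

/-- Data of a linearized problem `b(z, y, v) + ν (∇y, ∇v) = f(v)` with a skew-symmetric bounded
trilinear form, together with a solution operator `G`. -/
structure IsSkewPicard (gr : V →ₗ[ℝ] E) (B : V →ₗ[ℝ] V →ₗ[ℝ] V →ₗ[ℝ] ℝ) (M ν F : ℝ)
    (f : V → ℝ) (G : V → V) : Prop where
  norm_gr : ∀ v, ‖gr v‖ = ‖v‖
  skew : ∀ u v, B u v v = 0
  M_nonneg : 0 ≤ M
  bound : ∀ u v w, |B u v w| ≤ M * ‖u‖ * ‖v‖ * ‖w‖
  ν_pos : 0 < ν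
  F_nonneg : 0 ≤ F
  f_le : ∀ v, f v ≤ F * ‖v‖
  solves : ∀ z v, B z (G z) v + ν * inner ℝ (gr (G z)) (gr v) = f v

/-- Coercivity plus a skew trilinear form give a unique solution of the linearized problem. -/
theorem existsUnique_of_skew [FiniteDimensional ℝ V] (gr : V →ₗ[ℝ] E)
    (hgr : ∀ v, gr v = 0 → v = 0) (b : V →ₗ[ℝ] V →ₗ[ℝ] ℝ) (hb : ∀ v, b v v = 0) {ν : ℝ}
    (hν : 0 < ν) (f : V →ₗ[ℝ] ℝ) :
    ∃! y, ∀ v, b y v + ν * inner ℝ (gr y) (gr v) = f v := by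
  let a : V →ₗ[ℝ] Module.Dual ℝ V := b + ν • ((innerₗ E).compl₁₂ gr gr)
  have ha : ∀ y v, a y v = b y v + ν * inner ℝ (gr y) (gr v) := fun y v => rfl
  have hinj : Function.Injective a := by
    rw [injective_iff_map_eq_zero]
    intro y hy
    have h := ha y y
    rw [hy, hb, LinearMap.zero_apply, zero_add, real_inner_self_eq_norm_sq] at h
    have h2 : ‖gr y‖ ^ 2 = 0 := by
      rcases mul_eq_zero.1 h.symm with h | h
      · exact absurd h hν.ne'
      · exact h
    exact hgr y (norm_eq_zero.1 (pow_eq_zero_iff two_ne_zero |>.1 h2))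
  have hsurj : Function.Surjective a :=
    (LinearMap.injective_iff_surjective_of_finrank_eq_finrank
      (Subspace.dual_finrank_eq (K := ℝ) (V := V)).symm).1 hinj
  obtain ⟨y, hy⟩ := hsurj f
  refine ⟨y, fun v => by rw [← ha, hy], fun z hz => hinj ?_⟩
  rw [hy]
  exact LinearMap.ext fun v => by rw [ha]; exact hz v

/-! ### Energy estimates for the Picard operator. -/

namespace IsSkewPicard

variable {gr : V →ₗ[ℝ] E} {B : V →ₗ[ℝ] V →ₗ[ℝ] V →ₗ[ℝ] ℝ} {M ν F : ℝ} {f : V → ℝ} {G : V → V}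

/-- A coercivity estimate: testing with the unknown itself. -/
theorem norm_le_of_test (h : IsSkewPicard gr B M ν F f G) {y : V} {R : ℝ} (hR : 0 ≤ R)
    (hy : ν * inner ℝ (gr y) (gr y) ≤ R * ‖y‖) : ‖y‖ ≤ ν⁻¹ * R := by
  rw [real_inner_self_eq_norm_sq, h.norm_gr] at hy
  rcases (norm_nonneg y).eq_or_lt with h0 | h0
  · rw [← h0]; exact mul_nonneg (inv_nonneg.2 h.ν_pos.le) hR
  · have : ν * ‖y‖ ≤ R := le_of_mul_le_mul_right (by linarith [sq ‖y‖]) h0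
    rw [inv_mul_eq_div, le_div_iff₀ h.ν_pos]; linarith

/-- Testing with the solution itself kills the convection term. -/
theorem norm_le (h : IsSkewPicard gr B M ν F f G) (z : V) : ‖G z‖ ≤ ν⁻¹ * F := by
  refine h.norm_le_of_test h.F_nonneg ?_
  have := h.solves z (G z)
  rw [h.skew, zero_add] at this
  rw [this]
  exact h.f_le _

theorem kappa_nonneg (h : IsSkewPicard gr B M ν F f G) : 0 ≤ M * ν⁻¹ ^ 2 * F :=
  mul_nonneg (mul_nonneg h.M_nonneg (sq_nonneg _)) h.F_nonneg

/-- A Picard image in the second slot obeys an a priori bound; this is where the second factor of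
`ν⁻¹` and the factor `F` in `κ` originate. -/
theorem neg_B_le (h : IsSkewPicard gr B M ν F f G) (u z v : V) :
    -B u (G z) v ≤ M * ‖u‖ * (ν⁻¹ * F) * ‖v‖ := by
  refine (neg_le_abs _).trans ((h.bound _ _ _).trans ?_)
  have := h.M_nonneg
  have := h.norm_le z
  gcongr

/-- The Picard operator is Lipschitz with constant `κ = M ν⁻² F`. -/
theorem norm_sub_le (h : IsSkewPicard gr B M ν F f G) (z y : V) :
    ‖G z - G y‖ ≤ M * ν⁻¹ ^ 2 * F * ‖z - y‖ := by
  have hν := inv_nonneg.2 h.ν_pos.le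
  refine (h.norm_le_of_test (R := M * ‖z - y‖ * (ν⁻¹ * F)) ?_ ?_).trans (le_of_eq (by ring))
  · exact mul_nonneg (mul_nonneg h.M_nonneg (norm_nonneg _)) (mul_nonneg hν h.F_nonneg)
  · refine le_trans (le_of_eq ?_) (h.neg_B_le (z - y) z (G z - G y))
    have e1 := h.solves z (G z - G y)
    have e2 := h.solves y (G z - G y)
    -- The difference of the convection terms splits as `B (z - y) (G z) + B y (G z - G y)`, and the
    -- second part vanishes on this test vector.
    have e3 := h.skew y (G z - G y)
    simp only [map_sub, LinearMap.sub_apply, inner_sub_left] at e1 e2 e3 ⊢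
    linarith

/-- The residual estimate for the mixed iterate `u = (1 - b) G x + b G y`. -/
theorem norm_residual_mix_le (h : IsSkewPicard gr B M ν F f G) {x y u : V} {b : ℝ}
    (hu : u = (1 - b) • G x + b • G y) :
    ‖G u - u‖ ≤ M * ν⁻¹ ^ 2 * F * ‖(1 - b) • (G x - x) + b • (G y - y)‖
      + ν⁻¹ * M * |1 - b| * |b| * ‖x - y‖ * ‖G x - G y‖ := by
  have hν := inv_nonneg.2 h.ν_pos.le
  have hM := h.M_nonneg
  have hF := h.F_nonneg
  set wa := (1 - b) • (G x - x) + b • (G y - y) with hwa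
  refine (h.norm_le_of_test (R := M * ‖wa‖ * (ν⁻¹ * F)
    + |1 - b| * |b| * (M * ‖x - y‖ * ‖G x - G y‖)) (by positivity) ?_).trans
      (le_of_eq (by ring))
  have k1 := h.neg_B_le wa u (G u - u)
  have k2 : (1 - b) * b * B (x - y) (G x - G y) (G u - u)
      ≤ |1 - b| * |b| * (M * ‖x - y‖ * ‖G x - G y‖ * ‖G u - u‖) := by
    refine (le_abs_self _).trans ?_
    rw [abs_mul, abs_mul]
    exact mul_le_mul_of_nonneg_left (h.bound _ _ _) (by positivity)
  have e1 := h.solves u (G u - u)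
  have e2 := h.solves x (G u - u)
  have e3 := h.solves y (G u - u)
  -- At the mixed point, skewness allows exchanging `G u` for `u` in the second slot.
  have e4 := h.skew ((1 - b) • x + b • y) (G u - u)
  have key : ν * inner ℝ (gr (G u - u)) (gr (G u - u))
      = -B wa (G u) (G u - u) + (1 - b) * b * B (x - y) (G x - G y) (G u - u) := by
    have ei : inner ℝ (gr (G u - u)) (gr (G u - u))
        = inner ℝ (gr (G u)) (gr (G u - u)) - ((1 - b) * inner ℝ (gr (G x)) (gr (G u - u))
          + b * inner ℝ (gr (G y)) (gr (G u - u))) := by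
      rw [← real_inner_smul_left, ← real_inner_smul_left, ← inner_add_left, ← inner_sub_left,
        ← map_smul, ← map_smul, ← map_add, ← map_sub, ← hu]
    have ew : B wa (G u) (G u - u) = B u (G u) (G u - u)
        - B ((1 - b) • x + b • y) (G u) (G u - u) := by
      have hw : wa = u - ((1 - b) • x + b • y) := by rw [hwa, hu]; module
      rw [hw, map_sub B, LinearMap.sub_apply, LinearMap.sub_apply]
    -- The defect of bilinearity: mixing both slots differs from mixing the values by a product of
    -- differences.
    have ex : B ((1 - b) • x + b • y) u (G u - u)
        = (1 - b) * B x (G x) (G u - u) + b * B y (G y) (G u - u)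
          - (1 - b) * b * B (x - y) (G x - G y) (G u - u) := by
      conv_lhs => enter [1, 2]; rw [hu]
      simp only [map_add, map_sub, map_smul, LinearMap.add_apply, LinearMap.sub_apply,
        LinearMap.smul_apply, smul_eq_mul]
      ring
    have e4' : B ((1 - b) • x + b • y) (G u) (G u - u)
        = B ((1 - b) • x + b • y) u (G u - u) := by
      rw [← sub_eq_zero, ← LinearMap.sub_apply, ← map_sub, e4]
    rw [ei, ew, e4', ex]
    linear_combination e1 - (1 - b) * e2 - b * e3
  rw [key]
  linarith

end IsSkewPicard

/-- A depth-one accelerated sequence: each step mixes the last two updates so that the mixed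
residual has minimal norm. -/
structure IsMixing (G : V → V) (u : ℕ → V) (b : ℕ → ℝ) : Prop where
  first : u 1 = G (u 0)
  step : ∀ n, u (n + 2) = (1 - b n) • G (u (n + 1)) + b n • G (u n)
  minimal : ∀ n, ∀ t : ℝ,
    ‖(1 - b n) • (G (u (n + 1)) - u (n + 1)) + b n • (G (u n) - u n)‖
      ≤ ‖(1 - t) • (G (u (n + 1)) - u (n + 1)) + t • (G (u n) - u n)‖

/-! ### Consequences of optimal depth-one mixing for a contraction. -/

namespace IsMixing

variable {G : V → V} {u : ℕ → V} {b : ℕ → ℝ} {gr : V →ₗ[ℝ] E} {κ : ℝ}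

/-- First-order optimality on the affine line of mixed residuals, transported by `gr` to a space
with an inner product. -/
theorem inner_eq_zero (hm : IsMixing G u b) (hgr : ∀ v, ‖gr v‖ = ‖v‖) (n : ℕ) :
    inner ℝ (gr (G (u (n + 1)) - u (n + 1))
      + b n • gr ((G (u n) - u n) - (G (u (n + 1)) - u (n + 1))))
      (gr ((G (u n) - u n) - (G (u (n + 1)) - u (n + 1)))) = 0 := by
  refine inner_eq_zero_of_norm_le fun s => ?_
  have := hm.minimal n (b n + s)
  rw [← hgr, ← hgr] at this
  convert this using 2
  · rw [← map_smul, ← map_add]; congr 1; module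
  · rw [← map_smul, ← map_smul, ← map_add, ← map_add]; congr 1; module

omit [NormedSpace ℝ V] in
/-- Differences of iterates are controlled by differences of residuals. -/
theorem sub_mul_norm_le (hL : ∀ z y, ‖G z - G y‖ ≤ κ * ‖z - y‖) (x y : V) :
    (1 - κ) * ‖x - y‖ ≤ ‖(G y - y) - (G x - x)‖ := by
  have h1 : ‖x - y‖ ≤ ‖(G y - y) - (G x - x)‖ + ‖G x - G y‖ := by
    have : x - y = ((G y - y) - (G x - x)) + (G x - G y) := by abel
    conv_lhs => rw [this]
    exact norm_add_le _ _
  linarith [hL x y]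

/-- Orthogonality bounds `|b n|` times the residual difference, and contraction converts that
difference into one of iterates. It remains useful when `b n` is large. -/
theorem abs_mul_norm_le (hm : IsMixing G u b) (hgr : ∀ v, ‖gr v‖ = ‖v‖)
    (hL : ∀ z y, ‖G z - G y‖ ≤ κ * ‖z - y‖) (n : ℕ) :
    |b n| * ((1 - κ) * ‖u (n + 1) - u n‖) ≤ ‖G (u (n + 1)) - u (n + 1)‖ := by
  have := abs_mul_norm_le_of_inner_eq_zero (hm.inner_eq_zero hgr n)
  rw [hgr, hgr] at this
  exact (mul_le_mul_of_nonneg_left (sub_mul_norm_le hL _ _) (abs_nonneg _)).trans this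

/-- The increment `u_{n+1} - u_n` is controlled by the residual at `n`. -/
theorem norm_increment_le (hm : IsMixing G u b) (hgr : ∀ v, ‖gr v‖ = ‖v‖)
    (hL : ∀ z y, ‖G z - G y‖ ≤ κ * ‖z - y‖) (hκ0 : 0 ≤ κ) (hκ1 : κ < 1) :
    ∀ n, (1 - κ) * ‖u (n + 1) - u n‖ ≤ ‖G (u n) - u n‖
  | 0 => by
    rw [zero_add, hm.first]
    nlinarith [norm_nonneg (G (u 0) - u 0)]
  | n + 1 => by
    have e : u (n + 1 + 1) - u (n + 1)
        = (G (u (n + 1)) - u (n + 1)) - b n • (G (u (n + 1)) - G (u n)) := by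
      rw [hm.step]; module
    have h1 : ‖u (n + 1 + 1) - u (n + 1)‖
        ≤ ‖G (u (n + 1)) - u (n + 1)‖ + |b n| * (κ * ‖u (n + 1) - u n‖) := by
      rw [e]
      refine (norm_sub_le _ _).trans ?_
      rw [norm_smul, Real.norm_eq_abs]
      gcongr
      exact hL _ _
    have h2 := hm.abs_mul_norm_le hgr hL n
    have h3 : 0 ≤ 1 - κ := by linarith
    have h4 := mul_le_mul_of_nonneg_left h1 h3
    have h5 := mul_le_mul_of_nonneg_left h2 hκ0
    -- No induction is needed: the two terms contribute `(1 - κ)` and `κ` times the residual at `n +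
    -- 1`.
    nlinarith

/-- If an iteration stagnates then the residual vanishes. -/
theorem residual_eq_zero_of_increment_eq_zero (hm : IsMixing G u b) (hgr : ∀ v, ‖gr v‖ = ‖v‖)
    (hsep : ∀ v : V, ‖v‖ = 0 → v = 0)
    (hL : ∀ z y, ‖G z - G y‖ ≤ κ * ‖z - y‖) (hκ1 : κ < 1) :
    ∀ n, u (n + 1) = u n → G (u n) - u n = 0
  | 0 => fun h => by rw [← hm.first, zero_add] at *; rw [h, sub_self]
  | n + 1 => fun h => by
    have hw : G (u (n + 1)) - u (n + 1) = b n • (G (u (n + 1)) - G (u n)) := by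
      have := hm.step n
      rw [h] at this
      have h2 : G (u (n + 1)) - u (n + 1) - b n • (G (u (n + 1)) - G (u n))
          = ((1 - b n) • G (u (n + 1)) + b n • G (u n)) - u (n + 1) := by module
      rw [← this, sub_self] at h2
      exact sub_eq_zero.1 h2
    rcases eq_or_ne (b n) 0 with hb | hb
    · rw [hw, hb, zero_smul]
    have horth := hm.inner_eq_zero hgr n
    have e1 : gr (G (u (n + 1)) - u (n + 1))
        + b n • gr ((G (u n) - u n) - (G (u (n + 1)) - u (n + 1)))
        = b n • gr (u (n + 1) - u n) := by
      rw [← map_smul, ← map_add, ← map_smul]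
      congr 1
      conv_lhs => enter [1]; rw [hw]
      module
    have e2 : gr ((G (u n) - u n) - (G (u (n + 1)) - u (n + 1)))
        = gr (u (n + 1) - u n) - gr (G (u (n + 1)) - G (u n)) := by
      rw [← map_sub]; congr 1; abel
    -- With `δ = u (n + 1) - u n`, orthogonality now says that `‖δ‖ ^ 2` equals the inner product of
    -- `δ` with the difference of Picard images, which is at most `κ * ‖δ‖ ^ 2`; so `δ` vanishes.
    rw [e1, e2, real_inner_smul_left, inner_sub_right, real_inner_self_eq_norm_sq] at horth
    have h3 := (mul_eq_zero.1 horth).resolve_left hb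
    have h4 := real_inner_le_norm (gr (u (n + 1) - u n)) (gr (G (u (n + 1)) - G (u n)))
    rw [hgr, hgr] at h4
    rw [hgr] at h3
    have h5 := hL (u (n + 1)) (u n)
    have h6 : ‖u (n + 1) - u n‖ = 0 := by
      by_contra hne
      have hpos : 0 < ‖u (n + 1) - u n‖ := lt_of_le_of_ne (norm_nonneg _) (Ne.symm hne)
      have h7 := mul_le_mul_of_nonneg_left h5 hpos.le
      have h8 : 0 < (1 - κ) * ‖u (n + 1) - u n‖ ^ 2 := mul_pos (by linarith) (by positivity)
      nlinarith
    rw [hw, sub_eq_zero.1 (hsep _ h6), sub_self, smul_zero]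

/-- A nontrivial mixing coefficient gives a strict decrease of the mixed residual. -/
theorem norm_mix_lt (hm : IsMixing G u b) (hgr : ∀ v, ‖gr v‖ = ‖v‖)
    (hsep : ∀ v : V, ‖v‖ = 0 → v = 0)
    (hL : ∀ z y, ‖G z - G y‖ ≤ κ * ‖z - y‖) (hκ1 : κ < 1) {n : ℕ} (hb : b n ≠ 0)
    (hw : ‖G (u (n + 1)) - u (n + 1)‖ ≠ 0) :
    ‖(1 - b n) • (G (u (n + 1)) - u (n + 1)) + b n • (G (u n) - u n)‖
      < ‖G (u (n + 1)) - u (n + 1)‖ := by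
  set x := G (u (n + 1)) - u (n + 1) with hx
  set e := (G (u n) - u n) - x with he
  have horth := hm.inner_eq_zero hgr n
  rw [← hx, ← he] at horth
  have hmix : (1 - b n) • x + b n • (G (u n) - u n) = x + b n • e := by rw [he]; module
  have hpos : 0 < ‖e‖ := by
    refine lt_of_le_of_ne (norm_nonneg _) fun h0 => hw ?_
    have h1 := sub_mul_norm_le hL (u (n + 1)) (u n)
    rw [← hx, ← he, ← h0] at h1
    have h2 : ‖u (n + 1) - u n‖ = 0 :=
      le_antisymm (nonpos_of_mul_nonpos_right h1 (by linarith)) (norm_nonneg _)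
    have h3 := sub_eq_zero.1 (hsep _ h2)
    have h4 := hm.residual_eq_zero_of_increment_eq_zero hgr hsep hL hκ1 n h3
    rw [hx, h3, h4, norm_zero]
  have h1 : ‖gr x‖ ^ 2 = ‖gr x + b n • gr e‖ ^ 2 + (|b n| * ‖gr e‖) ^ 2 := by
    have : gr x = (gr x + b n • gr e) - b n • gr e := by abel
    conv_lhs => rw [this]
    rw [norm_sub_sq_real, real_inner_smul_right, horth, norm_smul, Real.norm_eq_abs]
    ring
  rw [← map_smul, ← map_add, hgr, hgr, hgr] at h1
  rw [hmix]
  refine lt_of_pow_lt_pow_left₀ 2 (norm_nonneg _) ?_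
  rw [h1]
  have : 0 < (|b n| * ‖e‖) ^ 2 := by have := abs_pos.2 hb; positivity
  linarith

end IsMixing

/-- The one-step estimate for depth-one mixing of the skew Picard operator. -/
theorem IsSkewPicard.norm_residual_mixing_le {gr : V →ₗ[ℝ] E} {B : V →ₗ[ℝ] V →ₗ[ℝ] V →ₗ[ℝ] ℝ}
    {M ν F κ : ℝ} {f : V → ℝ} {G : V → V} (h : IsSkewPicard gr B M ν F f G) {u : ℕ → V}
    {b : ℕ → ℝ} (hm : IsMixing G u b) (hκ : κ = M * ν⁻¹ ^ 2 * F) (hκ1 : κ < 1) {αbar : ℝ} {n : ℕ}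
    (hα : |1 - b n| ≤ αbar) :
    ‖G (u (n + 2)) - u (n + 2)‖
      ≤ κ * ‖(1 - b n) • (G (u (n + 1)) - u (n + 1)) + b n • (G (u n) - u n)‖
        + κ * ‖G (u (n + 1)) - u (n + 1)‖
          * (ν⁻¹ * M * αbar / (1 - κ) ^ 2 * ‖G (u n) - u n‖) := by
  have hκ0 : 0 ≤ κ := hκ ▸ h.kappa_nonneg
  have hL : ∀ z y, ‖G z - G y‖ ≤ κ * ‖z - y‖ := hκ ▸ h.norm_sub_le
  have h1 := h.norm_residual_mix_le (hm.step n)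
  rw [← hκ] at h1
  refine h1.trans (add_le_add_right ?_ _)
  have hM := h.M_nonneg
  have hν := h.ν_pos
  have hp : 0 < 1 - κ := by linarith
  have h2 := hm.abs_mul_norm_le h.norm_gr hL n
  have h3 := hm.norm_increment_le h.norm_gr hL hκ0 hκ1 n
  have h4 := hL (u (n + 1)) (u n)
  have hα0 : 0 ≤ αbar := (abs_nonneg _).trans hα
  set e := ‖u (n + 1) - u n‖ with he
  have he0 : 0 ≤ e := norm_nonneg _
  have h5 : |b n| * ((1 - κ) * e) * ((1 - κ) * e)
      ≤ ‖G (u (n + 1)) - u (n + 1)‖ * ‖G (u n) - u n‖ :=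
    mul_le_mul h2 h3 (by positivity) (norm_nonneg _)
  calc ν⁻¹ * M * |1 - b n| * |b n| * e * ‖G (u (n + 1)) - G (u n)‖
      ≤ ν⁻¹ * M * αbar * |b n| * e * (κ * e) := by gcongr
    -- One factor `1 - κ` goes to each copy of `e`, so that `h5` applies; the coefficient `|b n|` is
    -- absorbed there.
    _ = κ * (ν⁻¹ * M * αbar) / (1 - κ) ^ 2 * (|b n| * ((1 - κ) * e) * ((1 - κ) * e)) := by
        field_simp
    _ ≤ κ * (ν⁻¹ * M * αbar) / (1 - κ) ^ 2
          * (‖G (u (n + 1)) - u (n + 1)‖ * ‖G (u n) - u n‖) := by gcongr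
    _ = _ := by ring

/-! Depth-one Anderson iterations in terms of a single mixing coefficient. -/

theorem sum_window_one_zero {W : Type*} [AddCommMonoid W] (g : ℕ → W) :
    ∑ j ∈ window 1 0, g j = g 0 := by
  simp [window]

theorem sum_window_one_succ {W : Type*} [AddCommMonoid W] (g : ℕ → W) (n : ℕ) :
    ∑ j ∈ window 1 (n + 1), g j = g (n + 1) + g n := by
  have : window 1 (n + 1) = {n + 1, n} := by
    ext j
    simp only [window, Finset.mem_Icc, Finset.mem_insert, Finset.mem_singleton]
    omega
  rw [this, Finset.sum_pair (by omega)]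

theorem IsAndersonIteration.coeff_eq {G : V → V} {u ut : ℕ → V} {α : ℕ → ℕ → ℝ}
    (h : IsAndersonIteration G 1 u ut α) (n : ℕ) : α (n + 2) (n + 1) = 1 - α (n + 2) n := by
  have := h.sum_eq_one (n + 1)
  rw [sum_window_one_succ] at this
  linarith

/-- The sum constraint leaves one free parameter, the weight of the older update. -/
theorem IsAndersonIteration.isMixing {G : V → V} {u ut : ℕ → V} {α : ℕ → ℕ → ℝ}
    (h : IsAndersonIteration G 1 u ut α) : IsMixing G u fun n => α (n + 2) n where
  first := by
    have h1 := h.update 0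
    have h2 := h.sum_eq_one 0
    rw [sum_window_one_zero] at h1 h2
    rw [h1, h2, one_smul, h.fixedPointUpdate]
  step n := by
    rw [h.update (n + 1), sum_window_one_succ, h.fixedPointUpdate, h.fixedPointUpdate, h.coeff_eq]
  minimal n t := by
    have := h.minimal (n + 1) (fun j => if j = n then t else 1 - t)
      (by rw [sum_window_one_succ]; simp)
    rw [sum_window_one_succ, sum_window_one_succ, h.coeff_eq] at this
    simpa [h.fixedPointUpdate] using this

theorem IsAndersonIteration.isOptimizationGain {G : V → V} {u ut : ℕ → V} {α : ℕ → ℕ → ℝ}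
    (h : IsAndersonIteration G 1 u ut α) {n : ℕ} {θ : ℝ}
    (hθ : θ * ‖G (u (n + 1)) - u (n + 1)‖ = ‖(1 - α (n + 2) n) • (G (u (n + 1)) - u (n + 1))
      + α (n + 2) n • (G (u n) - u n)‖) :
    IsOptimizationGain 1 u ut (n + 1) θ := by
  have e : θ * ‖ut (n + 1 + 1) - u (n + 1)‖
      = ‖∑ j ∈ window 1 (n + 1), α (n + 1 + 1) j • (ut (j + 1) - u j)‖ := by
    rw [sum_window_one_succ, h.fixedPointUpdate, h.fixedPointUpdate, h.coeff_eq]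
    exact hθ
  refine ⟨⟨α (n + 1 + 1), h.sum_eq_one (n + 1), e⟩, ?_⟩
  rintro r ⟨β, hβ, rfl⟩
  rw [e]
  exact h.minimal (n + 1) β hβ

end Abstract

end SteadyNSE

namespace SteadyNSE

/-! ### The discrete Navier–Stokes problem as an instance of the abstract setting. -/

section Picard

variable {d : ℕ} {Ω : Set (Vec d)}

theorem bStar_self (u v : H10 Ω) : bStar u v v = 0 := sub_self _

theorem finiteDimensional_discDivFree (Xh : Submodule ℝ (H10 Ω)) (Qh : Submodule ℝ (L2Scal Ω))
    [FiniteDimensional ℝ Xh] : FiniteDimensional ℝ (discDivFree Xh Qh) :=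
  Submodule.finiteDimensional_of_le (fun _ hv => hv.1)

/-- On a finite-dimensional space the linearized problem is uniquely solvable, and `picardOp` is
its solution operator. -/
theorem isPicardSolution_iff (hd : d = 2 ∨ d = 3) (hΩ : Bornology.IsBounded Ω)
    (V : Submodule ℝ (H10 Ω)) [FiniteDimensional ℝ V] {ν : ℝ} (hν : 0 < ν)
    (f : StrongDual ℝ (H10 Ω)) (z y : V) :
    IsPicardSolution ν f V z y ↔ y = picardOp ν f V z := by
  have h : ∃! y, IsPicardSolution ν f V z y :=
    existsUnique_of_skew (H10.grad.comp V.subtype)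
      (fun v hv => Subtype.ext (H10.eq_zero_of_grad_eq_zero hd hΩ hv))
      (bStarLin hd hΩ V z) (fun v => bStar_self _ _) hν (f.toLinearMap.comp V.subtype)
  have hG : IsPicardSolution ν f V z (picardOp ν f V z) := Classical.epsilon_spec h.exists
  exact ⟨fun hy => h.unique hy hG, fun hy => hy ▸ hG⟩

theorem isSkewPicard_picardOp (hd : d = 2 ∨ d = 3) (hΩ : Bornology.IsBounded Ω)
    (V : Submodule ℝ (H10 Ω)) [FiniteDimensional ℝ V] {ν M : ℝ} (hν : 0 < ν)
    (hM : IsConvectionBound Ω M) (f : StrongDual ℝ (H10 Ω)) :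
    IsSkewPicard (H10.grad.comp V.subtype) (bStarLin hd hΩ V) M ν ‖f‖ (fun v : V => f v)
      (picardOp ν f V) where
  norm_gr _ := rfl
  skew _ _ := bStar_self _ _
  M_nonneg := hM.1
  bound u v w := hM.2 u v w
  ν_pos := hν
  F_nonneg := norm_nonneg f
  f_le v := (le_abs_self _).trans (f.le_opNorm v)
  solves z v := (isPicardSolution_iff hd hΩ V hν f z _).2 rfl v

end Picard

end SteadyNSE

end

theorem theorem4p1 {d : ℕ} (hd : d = 2 ∨ d = 3) (Ω : Set (SteadyNSE.Vec d))
    (hΩ_open : IsOpen Ω) (hΩ_conn : IsConnected Ω) (hΩ_bdd : Bornology.IsBounded Ω) :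
    -- a constant `M`, depending only on `Ω`, exists, and the result holds for every such `M`
    (∃ M : ℝ, SteadyNSE.IsConvectionBound Ω M) ∧
    ∀ M : ℝ, SteadyNSE.IsConvectionBound Ω M →
    ∀ (Xh : Submodule ℝ (SteadyNSE.H10 Ω)) (Qh : Submodule ℝ (SteadyNSE.L2Scal Ω)),
      FiniteDimensional ℝ Xh → FiniteDimensional ℝ Qh → (∀ q ∈ Qh, ∫ x in Ω, q x = 0) →
    ∀ (ν : ℝ) (f : StrongDual ℝ (SteadyNSE.H10 Ω)) (κ : ℝ),
      0 < ν → κ = SteadyNSE.kappa M ν f → κ < 1 →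
    ∀ G : SteadyNSE.discDivFree Xh Qh → SteadyNSE.discDivFree Xh Qh,
      G = SteadyNSE.picardOp ν f (SteadyNSE.discDivFree Xh Qh) →
    -- `G` is well defined: `G z` is the one and only solution of the linearized problem at `z`
    (∀ z y : SteadyNSE.discDivFree Xh Qh,
      SteadyNSE.IsPicardSolution ν f (SteadyNSE.discDivFree Xh Qh) z y ↔ y = G z) ∧
    ∀ (u ut : ℕ → SteadyNSE.discDivFree Xh Qh) (α : ℕ → ℕ → ℝ),
      SteadyNSE.IsAndersonIteration G 1 u ut α →
    ∀ w : ℕ → SteadyNSE.discDivFree Xh Qh, w = SteadyNSE.residual G u →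
    -- the step `k = n + 2`
    ∀ (αbar C₀ : ℝ) (n : ℕ), |α (n + 2) (n + 1)| < αbar → α (n + 2) n ≠ 0 →
      C₀ = ν⁻¹ * M * αbar / (1 - κ) ^ 2 →
      ∃ θ : ℝ, 0 ≤ θ ∧ θ < 1 ∧ SteadyNSE.IsOptimizationGain 1 u ut (n + 1) θ ∧
        ‖w (n + 2)‖ ≤ κ * ‖w (n + 1)‖ * (θ + C₀ * ‖w n‖) ∧
        -- strictly better than the Picard factor `κ` once `‖∇w_{k-2}‖` is small
        (0 < κ * ‖w (n + 1)‖ → C₀ * ‖w n‖ < 1 - θ → ‖w (n + 2)‖ < κ * ‖w (n + 1)‖) := by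
  refine ⟨SteadyNSE.exists_isConvectionBound hd hΩ_bdd, ?_⟩
  intro M hM Xh Qh hXh _ _ ν f κ hν hκ hκ1 G hG
  have := SteadyNSE.finiteDimensional_discDivFree Xh Qh
  subst hG
  refine ⟨SteadyNSE.isPicardSolution_iff hd hΩ_bdd _ hν f, ?_⟩
  intro u ut α hA w hw αbar C₀ n hα hαn hC₀
  have hS := SteadyNSE.isSkewPicard_picardOp hd hΩ_bdd (SteadyNSE.discDivFree Xh Qh) hν hM f
  set G := SteadyNSE.picardOp ν f (SteadyNSE.discDivFree Xh Qh)
  have hm := hA.isMixing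
  have hw' : ∀ k, G (u k) - u k = w k := fun k => by rw [hw]; rfl
  have hL : ∀ z y, ‖G z - G y‖ ≤ κ * ‖z - y‖ := hκ ▸ hS.norm_sub_le
  have hsep : ∀ v : SteadyNSE.discDivFree Xh Qh, ‖v‖ = 0 → v = 0 := fun v hv =>
    Subtype.ext (SteadyNSE.H10.eq_zero_of_grad_eq_zero hd hΩ_bdd (norm_eq_zero.1 hv))
  have hα' : |1 - α (n + 2) n| ≤ αbar := by rw [← hA.coeff_eq]; exact hα.le
  have hest := hS.norm_residual_mixing_le hm hκ hκ1 hα'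
  rw [← hC₀] at hest
  have hgain : ∃ θ : ℝ, 0 ≤ θ ∧ θ < 1 ∧ θ * ‖G (u (n + 1)) - u (n + 1)‖
      = ‖(1 - α (n + 2) n) • (G (u (n + 1)) - u (n + 1)) + α (n + 2) n • (G (u n) - u n)‖ := by
    -- If the last residual vanishes, the minimum is zero too and `θ = 0` serves; otherwise `θ` is
    -- the quotient of the two norms.
    by_cases h0 : ‖G (u (n + 1)) - u (n + 1)‖ = 0
    · refine ⟨0, le_rfl, one_pos, ?_⟩
      have := hm.minimal n 0
      rw [sub_zero, one_smul, zero_smul, add_zero, h0] at this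
      rw [zero_mul]
      exact le_antisymm (norm_nonneg _) this
    · have hlt := hm.norm_mix_lt hS.norm_gr hsep hL hκ1 hαn h0
      exact ⟨_ / ‖G (u (n + 1)) - u (n + 1)‖, by positivity,
        (div_lt_one (lt_of_le_of_ne (norm_nonneg _) (Ne.symm h0))).2 hlt, div_mul_cancel₀ _ h0⟩
  obtain ⟨θ, hθ0, hθ1, hθ⟩ := hgain
  have hmain : ‖w (n + 2)‖ ≤ κ * ‖w (n + 1)‖ * (θ + C₀ * ‖w n‖) := by
    rw [← hθ] at hest
    simp only [hw'] at hest
    linarith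
  refine ⟨θ, hθ0, hθ1, hA.isOptimizationGain hθ, hmain, fun hpos hsmall => hmain.trans_lt ?_⟩
  exact mul_lt_of_lt_one_right hpos (by linarith)
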